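/- Let $\omega:=\frac{-1+\sqrt{3}\,i}{2}$, a primitive cube root of unity, let $\gamma$ denote Euler's constant, and let $(2n)^{1/3}$ denote the positive real cube root. Let $\alpha,\beta>0$ be real numbers such that $\alpha\beta^3=\pi^4$. Then the four series below converge absolutely, and $$\begin{aligned} &\sum_{n=1}^{\infty}\frac{1}{n\left(\exp(8n^3\alpha)-1\right)}+\frac13\Bigg(\sum_{n=1}^{\infty}\frac{1}{n\left(\exp\left((2n)^{1/3}\beta\right)-1\right)}\\ &\quad-\sum_{n=1}^{\infty}\frac{1}{n\left(\exp\left(-(2n)^{1/3}\beta\omega\right)-1\right)}-\sum_{n=1}^{\infty}\frac{1}{n\left(\exp\left(-(2n)^{1/3}\beta\omega^2\right)-1\right)}\Bigg)\\ &=\frac13\left(\log 2-\gamma\right)+\frac18\log\left(\frac{\alpha}{\beta}\right)+\frac{\beta^3}{720}. \end{aligned}$$ -/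

import Mathlib

open Filter Topology

/-! Put A = π/(4α) and sum x²/(x⁶ + A²y²) over the lattice points x = n, y = k ≥ 1 in both orders.
Over k, the expansion of coth gives the first Lambert term plus 1/(2n) and a multiple of 1/n⁴; over
n, partial fractions along the cube roots of unity give the other three.

The double sum diverges logarithmically, so the exchange is made on the block n ≤ N, k ≤ K with K =
⌊N³/A⌋. By the integral test, what the block misses in its rows (n ≤ N, k > K) and in its columns (k
≤ K, n > N) are, up to o(1), Riemann sums; both tend to (1/(3A)) ∫₀¹ arctan u / u du, and so they
cancel (`tendsto_iterated_sum_sub`). The constant comes from the rest: ζ(4) produces β³/720, and the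
harmonic sums of lengths N and K produce γ and log A. -/

/-- The Mittag-Leffler expansion of `1 / (exp (2πz) - 1)` in the right half-plane. -/
theorem hasSum_one_div_sq_add_nat_sq {z : ℂ} (hz : 0 < z.re) :
    HasSum (fun k : ℕ => 1 / (z ^ 2 + ((k : ℂ) + 1) ^ 2))
      (Real.pi / z * (1 / (Complex.exp (2 * Real.pi * z) - 1) + 1 / 2 - 1 / (2 * Real.pi * z))) := by
  have hz0 : z ≠ 0 := by rintro rfl; simp at hz
  have hπ : (Real.pi : ℂ) ≠ 0 := by exact_mod_cast Real.pi_ne_zero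
  have hx : -Complex.I * z ∈ Complex.integerComplement := by
    rintro ⟨n, hn⟩
    have := congrArg Complex.im hn
    simp at this
    linarith
  have hE : Complex.exp (2 * Real.pi * z) - 1 ≠ 0 := by
    rw [sub_ne_zero]
    intro h
    have h' := congrArg norm h
    rw [Complex.norm_exp, norm_one, Real.exp_eq_one_iff] at h'
    simp [Real.pi_ne_zero] at h'
    linarith
  have hne (k : ℕ) : z ^ 2 + ((k : ℂ) + 1) ^ 2 ≠ 0 := by
    have := Complex.integerComplement_pow_two_ne_pow_two hx (k + 1)
    contrapose this
    push_cast
    linear_combination (-1 : ℂ) * this + z ^ 2 * Complex.I_sq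
  have hs : HasSum (fun k : ℕ => 1 / (-Complex.I * z - (k + 1)) + 1 / (-Complex.I * z + (k + 1)))
      (Real.pi * Complex.cot (Real.pi * (-Complex.I * z)) - 1 / (-Complex.I * z)) := by
    rw [cot_series_rep' hx]
    exact (summable_cotTerm hx).hasSum
  -- With x = -iz and m = k + 1, 1/(x - m) + 1/(x + m) = 2iz/(z² + m²); this factor normalises it.
  convert! hs.mul_left (-Complex.I / (2 * z)) using 1
  · ext k
    have h1 : -Complex.I * z - ((k : ℂ) + 1) ≠ 0 := by
      have := Complex.integerComplement_add_ne_zero hx (-(k + 1))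
      push_cast at this
      rwa [← sub_eq_add_neg] at this
    have h2 : -Complex.I * z + ((k : ℂ) + 1) ≠ 0 := by
      have := Complex.integerComplement_add_ne_zero hx (k + 1)
      push_cast at this
      convert this using 1
    have h3 := hne k
    rw [div_add_div _ _ h1 h2, div_mul_div_comm, div_eq_div_iff h3
      (mul_ne_zero (by simpa using hz0) (mul_ne_zero h1 h2))]
    linear_combination (-2 * (z^2 + ((k : ℂ) + 1) ^ 2) * z + 2 * z ^ 3) * Complex.I_sq
  · rw [Complex.cot_pi_eq_exp_ratio]
    have : 2 * Real.pi * Complex.I * (-Complex.I * z) = 2 * Real.pi * z := by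
      linear_combination (-2 * Real.pi * z) * Complex.I_sq
    rw [this]
    set E := Complex.exp (2 * Real.pi * z)
    have hE' : 1 - E ≠ 0 := by
      rw [← neg_sub]; exact neg_ne_zero.mpr hE
    have hI := Complex.I_ne_zero
    rw [show (1 : ℂ) - E = -(E - 1) by ring]
    field_simp
    ring_nf

/-! ### Row and column sums of the kernel -/

/-- The kernel `x² / (x⁶ + A² y²)` of the double lattice sum. -/
noncomputable def latticeKernel (A x y : ℝ) : ℝ := x ^ 2 / (x ^ 6 + A ^ 2 * y ^ 2)

theorem hasSum_latticeKernel_right {A x : ℝ} (hA : 0 < A) (hx : 0 < x) :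
    HasSum (fun k : ℕ => latticeKernel A x (k + 1))
      (Real.pi / A * (1 / (x * (Real.exp (2 * Real.pi * (x ^ 3 / A)) - 1)) + 1 / (2 * x)
        - A / (2 * Real.pi * x ^ 4))) := by
  have hz : 0 < (((x ^ 3 / A : ℝ)) : ℂ).re := by rw [Complex.ofReal_re]; positivity
  have h := hasSum_one_div_sq_add_nat_sq hz
  have h' : HasSum (fun k : ℕ => 1 / ((x ^ 3 / A) ^ 2 + ((k : ℝ) + 1) ^ 2))
      (Real.pi / (x ^ 3 / A) * (1 / (Real.exp (2 * Real.pi * (x ^ 3 / A)) - 1) + 1 / 2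
        - 1 / (2 * Real.pi * (x ^ 3 / A)))) := by
    rw [← Complex.hasSum_ofReal]
    convert! h using 1
    · ext k; push_cast; rfl
    · push_cast; rfl
  have hE : Real.exp (2 * Real.pi * (x ^ 3 / A)) - 1 ≠ 0 := by
    rw [sub_ne_zero, Ne, Real.exp_eq_one_iff]
    positivity
  convert! h'.mul_left (x ^ 2 / A ^ 2) using 1
  · ext k
    unfold latticeKernel
    have : x ^ 6 + A ^ 2 * ((k : ℝ) + 1) ^ 2 ≠ 0 := by positivity
    have : (x ^ 3 / A) ^ 2 + ((k : ℝ) + 1) ^ 2 ≠ 0 := by positivity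
    have : x ^ 3 ^ 2 + A ^ 2 * ((k : ℝ) + 1) ^ 2 ≠ 0 := by positivity
    field_simp
  · have := Real.pi_ne_zero
    field_simp

/-- The polynomial m⁶ + c⁶ is the product of m² + z² over z = c, -cω, -cω², all in the right
half-plane. Partial fractions carry the weights 1, ω, ω², and these make the 1/z² terms of the three
expansions cancel, as 1 + ω + ω² = 0. -/
theorem hasSum_latticeKernel_left {A y c : ℝ} (hc : 0 < c)
    (hcy : c ^ 3 = A * y) {ω : ℂ} (hω : ω = (-1 + (Real.sqrt 3 : ℂ) * Complex.I) / 2) :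
    HasSum (fun n : ℕ => (latticeKernel A (n + 1) y : ℂ))
      (Real.pi / (3 * A * y) * (1 / 2 - (1 / (Complex.exp (2 * Real.pi * c) - 1)
        - 1 / (Complex.exp (2 * Real.pi * (-c * ω)) - 1)
        - 1 / (Complex.exp (2 * Real.pi * (-c * ω ^ 2)) - 1)))) := by
  have hs3 : (Real.sqrt 3 : ℂ) ^ 2 = 3 := by
    norm_cast; exact Real.sq_sqrt (by norm_num)
  have hq : ω ^ 2 + ω + 1 = 0 := by
    rw [hω]
    linear_combination (1 / 4 : ℂ) * (Real.sqrt 3 : ℂ) ^ 2 * Complex.I_sq - (1 / 4 : ℂ) * hs3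
  have hre : ω.re = -1 / 2 := by rw [hω]; simp
  have hω2 : ω ^ 2 = -1 - ω := by linear_combination hq
  have hc' : (c : ℂ) ≠ 0 := by exact_mod_cast hc.ne'
  have hω0 : ω ≠ 0 := by rintro rfl; simp at hq
  have hπ : (Real.pi : ℂ) ≠ 0 := by exact_mod_cast Real.pi_ne_zero
  have r1 : 0 < (-c * ω : ℂ).re := by simp [hre]; linarith
  have r2 : 0 < (-c * ω ^ 2 : ℂ).re := by rw [hω2]; simp [hre]; linarith
  have h0 := hasSum_one_div_sq_add_nat_sq (z := (c : ℂ)) (by simpa using hc)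
  have h1 := hasSum_one_div_sq_add_nat_sq r1
  have h2 := hasSum_one_div_sq_add_nat_sq r2
  have hAy : (A : ℂ) * y = c ^ 3 := by exact_mod_cast hcy.symm
  have h3 : ω ^ 3 = 1 := by linear_combination (ω - 1) * hq
  have hsum := ((h0.add (h1.mul_left ω)).add (h2.mul_left (ω ^ 2))).mul_left (-1 / (3 * (c : ℂ) ^ 2))
  convert! hsum using 1
  · ext n
    unfold latticeKernel
    set m : ℂ := (n : ℂ) + 1 with hm
    have e1 : (-c * ω : ℂ) ^ 2 = -(c ^ 2 * (1 + ω)) := by linear_combination c ^ 2 * hq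
    have e2 : (-c * ω ^ 2 : ℂ) ^ 2 = c ^ 2 * ω := by linear_combination c ^ 2 * ω * h3
    have hc6 : (A : ℂ) ^ 2 * y ^ 2 = c ^ 6 := by rw [← mul_pow, hAy]; ring
    have d : (c : ℂ) ^ 6 + m ^ 6 ≠ 0 := by
      rw [hm]; norm_cast; positivity
    have fac : (c : ℂ) ^ 6 + m ^ 6 =
        (c ^ 2 + m ^ 2) * (-(c ^ 2 * (1 + ω)) + m ^ 2) * (c ^ 2 * ω + m ^ 2) := by
      linear_combination (c ^ 2 + m ^ 2) * (c : ℂ) ^ 4 * hq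
    have d12 := d
    rw [fac] at d12
    have d01 := left_ne_zero_of_mul d12
    have d0 := left_ne_zero_of_mul d01
    have d1 := right_ne_zero_of_mul d01
    have d2 := right_ne_zero_of_mul d12
    push_cast
    rw [hc6, ← hm, e1, e2, mul_one_div, mul_one_div, div_add_div _ _ d0 d1,
      div_add_div _ _ d01 d2, ← fac, add_comm (m ^ 6), div_mul_div_comm,
      div_eq_div_iff d (by simp [hc', d])]
    have num : (1 * (-(c ^ 2 * (1 + ω)) + m ^ 2) + (c ^ 2 + m ^ 2) * ω) * (c ^ 2 * ω + m ^ 2) +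
        (c ^ 2 + m ^ 2) * (-(c ^ 2 * (1 + ω)) + m ^ 2) * ω ^ 2 = -3 * c ^ 2 * m ^ 2 := by
      linear_combination ((c : ℂ) ^ 4 + 2 * c ^ 2 * m ^ 2 +
        (c ^ 2 + m ^ 2) * (-(c ^ 2 * (1 + ω)) + m ^ 2)) * hq
    rw [num]
    ring
  · have e3 : 3 * (A : ℂ) * y = 3 * c ^ 3 := by rw [mul_assoc, hAy]
    rw [e3]
    generalize 1 / (Complex.exp (2 * Real.pi * c) - 1) = u0
    generalize 1 / (Complex.exp (2 * Real.pi * (-c * ω)) - 1) = u1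
    generalize 1 / (Complex.exp (2 * Real.pi * (-c * ω ^ 2)) - 1) = u2
    have f1 : (Real.pi : ℂ) / (-c * ω) = -(Real.pi / c) * ω ^ 2 := by
      field_simp; linear_combination h3
    have f2 : (Real.pi : ℂ) / (-c * ω ^ 2) = -(Real.pi / c) * ω := by
      field_simp; linear_combination h3
    have f3 : (1 : ℂ) / (2 * Real.pi * (-c * ω)) = -(1 / (2 * Real.pi * c)) * ω ^ 2 := by
      field_simp; linear_combination h3
    have f4 : (1 : ℂ) / (2 * Real.pi * (-c * ω ^ 2)) = -(1 / (2 * Real.pi * c)) * ω := by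
      field_simp; linear_combination h3
    rw [f1, f2, f3, f4]
    linear_combination -(Real.pi : ℂ) / (3 * c ^ 3) * (1 / (2 * Real.pi * c)) * hq
      - (Real.pi : ℂ) / (3 * c ^ 3) * (u1 + u2 + 1 + 1 / (2 * Real.pi * c) * (ω ^ 2 + ω)) * h3

/-! ### Integral test and Riemann sums -/

/-- Integral test: a tail of a decreasing series is approximated by the tail of the integral. -/
theorem abs_tail_sub_antideriv_le {g G : ℝ → ℝ} {a S : ℝ}
    (hG : ∀ x, a ≤ x → HasDerivAt G (-g x) x) (hg : AntitoneOn g (Set.Ici a))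
    (hg0 : ∀ x, 0 ≤ g x) (hlim : Tendsto G atTop (𝓝 0))
    (hS : HasSum (fun k : ℕ => g (a + k + 1)) S) : |S - G a| ≤ g a := by
  have hstep (k : ℕ) : g (a + k + 1) ≤ G (a + k) - G (a + k + 1) ∧
      G (a + k) - G (a + k + 1) ≤ g (a + k) := by
    have hk : (0 : ℝ) ≤ k := k.cast_nonneg
    obtain ⟨ξ, hξ, h⟩ := exists_hasDerivAt_eq_slope G (fun x => -g x)
      (show a + k < a + k + 1 by linarith)
      (fun x hx => (hG x (by linarith [hx.1])).continuousAt.continuousWithinAt)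
      (fun x hx => hG x (by linarith [hx.1]))
    have h1 : g (a + k + 1) ≤ g ξ :=
      hg (Set.mem_Ici.2 (by linarith [hξ.1])) (Set.mem_Ici.2 (by linarith)) hξ.2.le
    have h2 : g ξ ≤ g (a + k) :=
      hg (Set.mem_Ici.2 (by linarith)) (Set.mem_Ici.2 (by linarith [hξ.1])) hξ.1.le
    rw [show a + k + 1 - (a + k) = 1 by ring, div_one] at h
    constructor <;> linarith
  -- Both bounds telescope; the second one shifts the sum of g(a + k) by one index, which leaves
  -- g(a) - g(a + N).
  have hpart (N : ℕ) : (∑ k ∈ Finset.range N, g (a + k + 1)) ≤ G a - G (a + N) ∧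
      G a - G (a + N) ≤ g a - g (a + N) + ∑ k ∈ Finset.range N, g (a + k + 1) := by
    induction N with
    | zero => simp
    | succ N ih =>
      rw [Finset.sum_range_succ]
      have := hstep N
      push_cast
      rw [← add_assoc]
      constructor <;> linarith [ih.1, ih.2, this.1, this.2]
  have hl : Tendsto (fun N : ℕ => G a - G (a + N)) atTop (𝓝 (G a)) := by
    have : Tendsto (fun N : ℕ => G (a + N)) atTop (𝓝 0) :=
      hlim.comp (tendsto_atTop_add_const_left _ _ tendsto_natCast_atTop_atTop)
    simpa using this.const_sub (G a)
  have u := le_of_tendsto_of_tendsto' hS.tendsto_sum_nat hl fun N => (hpart N).1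
  have l := le_of_tendsto_of_tendsto' hl (hS.tendsto_sum_nat.const_add (g a)) fun N => by
    linarith [(hpart N).2, hg0 (a + N)]
  rw [abs_le]
  constructor <;> linarith [hg0 a]

/-- Right Riemann sums of a continuous function on the unit interval. -/
theorem tendsto_riemann_sum {f : ℝ → ℝ} (hf : Continuous f) :
    Tendsto (fun N : ℕ => ∑ n ∈ Finset.range N, f ((n + 1) / N) / N) atTop
      (𝓝 (∫ x in (0 : ℝ)..1, f x)) := by
  have huc := isCompact_Icc.uniformContinuousOn_of_continuous (s := Set.Icc (0 : ℝ) 1)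
    hf.continuousOn
  rw [Metric.uniformContinuousOn_iff] at huc
  rw [Metric.tendsto_atTop]
  intro ε hε
  obtain ⟨δ, hδ, h⟩ := huc (ε / 2) (by positivity)
  obtain ⟨M, hM⟩ := exists_nat_one_div_lt hδ
  refine ⟨M + 1, fun N hN => ?_⟩
  have hN0 : (0 : ℝ) < N := by exact_mod_cast (by omega : 0 < N)
  have hNδ : 1 / (N : ℝ) < δ := by
    refine lt_of_le_of_lt (one_div_le_one_div_of_le (by positivity) ?_) hM
    exact_mod_cast hN
  have hsplit : ∫ x in (0 : ℝ)..1, f x =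
      ∑ n ∈ Finset.range N, ∫ x in ((n : ℝ) / N)..((n + 1 : ℝ) / N), f x := by
    have := intervalIntegral.sum_integral_adjacent_intervals (f := f) (μ := MeasureTheory.volume)
      (a := fun n : ℕ => (n : ℝ) / N) (n := N) (fun k _ => hf.intervalIntegrable _ _)
    rw [div_self hN0.ne'] at this
    simpa using this.symm
  have hterm (n : ℕ) (hn : n ∈ Finset.range N) :
      |f ((n + 1) / N) / N - ∫ x in ((n : ℝ) / N)..((n + 1 : ℝ) / N), f x| ≤ ε / 2 / N := by
    have hn1 : (n : ℝ) + 1 ≤ N := by exact_mod_cast Finset.mem_range.1 hn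
    have hlen : ((n : ℝ) + 1) / N - n / N = 1 / N := by ring
    have hc : f ((n + 1) / N) / N = ∫ _ in ((n : ℝ) / N)..((n + 1 : ℝ) / N), f ((n + 1) / N) := by
      rw [intervalIntegral.integral_const, hlen, smul_eq_mul]; ring
    rw [hc, ← intervalIntegral.integral_sub (by simp) (hf.intervalIntegrable _ _),
      ← Real.norm_eq_abs]
    have hle : (n : ℝ) / N ≤ (n + 1) / N := by gcongr; linarith
    have h1 : ((n : ℝ) + 1) / N ≤ 1 := by rw [div_le_one hN0]; exact hn1
    have h0 : 0 ≤ (n : ℝ) / N := by positivity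
    refine (intervalIntegral.norm_integral_le_of_norm_le_const (C := ε / 2) fun x hx => ?_).trans ?_
    · rw [Set.uIoc_of_le hle] at hx
      rw [← dist_eq_norm]
      refine (h _ ⟨by linarith, h1⟩ _ ⟨by linarith [hx.1], by linarith [hx.2]⟩ ?_).le
      rw [Real.dist_eq, abs_of_nonneg (by linarith [hx.2])]
      linarith [hx.1]
    · rw [hlen, abs_of_pos (by positivity)]
      exact le_of_eq (by ring)
  rw [Real.dist_eq, hsplit, ← Finset.sum_sub_distrib]
  calc _ ≤ ∑ n ∈ Finset.range N, ε / 2 / N :=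
        (Finset.abs_sum_le_sum_abs _ _).trans (Finset.sum_le_sum hterm)
    _ = ε / 2 := by
        rw [Finset.sum_const, Finset.card_range, nsmul_eq_mul]; field_simp
    _ < ε := by linarith

/-- This is arctan u / u with its singularity at 0 removed, so Riemann sums on all of [0, 1] apply.
-/
theorem continuous_dslope_arctan : Continuous (dslope Real.arctan 0) := by
  rw [← continuousOn_univ]
  exact (continuousOn_dslope Filter.univ_mem).2
    ⟨Real.continuous_arctan.continuousOn, Real.differentiable_arctan 0⟩

theorem dslope_arctan_zero {u : ℝ} (hu : u ≠ 0) : dslope Real.arctan 0 u = Real.arctan u / u := by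
  rw [dslope_of_ne _ hu, slope_def_field]; simp

theorem abs_arctan_sub_arctan_le (x y : ℝ) : |Real.arctan x - Real.arctan y| ≤ |x - y| := by
  have := Convex.norm_image_sub_le_of_norm_deriv_le (f := Real.arctan) (s := Set.univ) (C := 1)
    (x := y) (y := x) (fun z _ => Real.differentiable_arctan z) (fun z _ => by
      rw [Real.deriv_arctan, Real.norm_eq_abs, abs_of_pos (by positivity), div_le_one (by positivity)]
      nlinarith [sq_nonneg z]) convex_univ trivial trivial
  simpa using this

theorem integral_sq_mul_comp_cube {f : ℝ → ℝ} (hf : Continuous f) :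
    ∫ x in (0 : ℝ)..1, x ^ 2 * f (x ^ 3) = (∫ x in (0 : ℝ)..1, f x) / 3 := by
  have := intervalIntegral.integral_comp_mul_deriv (a := 0) (b := 1) (f := fun x : ℝ => x ^ 3)
    (f' := fun x => 3 * x ^ 2) (g := f) (fun x _ => by simpa using hasDerivAt_pow 3 x)
    (by fun_prop) hf
  norm_num at this
  rw [← this, eq_div_iff (by norm_num), mul_comm, ← intervalIntegral.integral_const_mul]
  congr 1
  ext x
  ring

/-- If `ρ_N → 1`, then `∑_{k ≤ N} arctan (ρ_N k / N) / k` tends to `∫₀¹ arctan u / u du`. -/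
theorem tendsto_sum_arctan_linear {ι : Type*} {l : Filter ι} {K : ι → ℕ} {ρ : ι → ℝ}
    (hK : Tendsto K l atTop) (hρ : Tendsto ρ l (𝓝 1)) :
    Tendsto (fun i => ∑ k ∈ Finset.range (K i),
        1 / ((k : ℝ) + 1) * Real.arctan (ρ i * ((k + 1) / K i))) l
      (𝓝 (∫ u in (0 : ℝ)..1, dslope Real.arctan 0 u)) := by
  have h1 := (tendsto_riemann_sum continuous_dslope_arctan).comp hK
  have h2 : Tendsto (fun i => |ρ i - 1|) l (𝓝 0) := by
    simpa using (hρ.sub_const 1).abs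
  refine h1.congr_dist (squeeze_zero (fun _ => dist_nonneg) (fun i => ?_) h2)
  rw [Function.comp_apply, dist_comm, Real.dist_eq, ← Finset.sum_sub_distrib]
  rcases Nat.eq_zero_or_pos (K i) with h0 | h0
  · simp [h0]
  have hK0 : (0 : ℝ) < K i := by exact_mod_cast h0
  calc _ ≤ ∑ k ∈ Finset.range (K i), |ρ i - 1| / K i := by
        refine (Finset.abs_sum_le_sum_abs _ _).trans (Finset.sum_le_sum fun k _ => ?_)
        have hk : (0 : ℝ) < k + 1 := by positivity
        have hu : ((k : ℝ) + 1) / K i ≠ 0 := by positivity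
        rw [dslope_arctan_zero hu]
        have e : Real.arctan (((k : ℝ) + 1) / K i) / ((k + 1) / K i) / K i =
            1 / ((k : ℝ) + 1) * Real.arctan ((k + 1) / K i) := by field_simp
        rw [e, ← mul_sub, abs_mul, abs_of_pos (by positivity)]
        refine (mul_le_mul_of_nonneg_left (abs_arctan_sub_arctan_le _ _) (by positivity)).trans ?_
        rw [← sub_one_mul, abs_mul, abs_of_pos (show 0 < ((k : ℝ) + 1) / K i by positivity)]
        exact le_of_eq (by field_simp)
    _ = |ρ i - 1| := by
        rw [Finset.sum_const, Finset.card_range, nsmul_eq_mul]; field_simp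

/-- With φ(u) = arctan u / u, the sum for ρ = 1 is a Riemann sum of x² φ(x³); substituting u = x³
yields the factor 1/3. The Lipschitz bound on arctan absorbs ρ. -/
theorem tendsto_sum_arctan_cubic {ρ : ℕ → ℝ} (hρ : Tendsto ρ atTop (𝓝 1)) :
    Tendsto (fun N : ℕ => ∑ n ∈ Finset.range N,
        1 / ((n : ℝ) + 1) * Real.arctan (ρ N * ((n + 1) / N) ^ 3)) atTop
      (𝓝 ((∫ u in (0 : ℝ)..1, dslope Real.arctan 0 u) / 3)) := by
  have hc := continuous_dslope_arctan
  have h1 := tendsto_riemann_sum (f := fun x => x ^ 2 * dslope Real.arctan 0 (x ^ 3)) (by fun_prop)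
  rw [integral_sq_mul_comp_cube hc] at h1
  have h2 : Tendsto (fun i => |ρ i - 1|) atTop (𝓝 0) := by
    simpa using (hρ.sub_const 1).abs
  refine h1.congr_dist (squeeze_zero (fun _ => dist_nonneg) (fun N => ?_) h2)
  rw [dist_comm, Real.dist_eq, ← Finset.sum_sub_distrib]
  rcases Nat.eq_zero_or_pos N with h0 | h0
  · simp [h0]
  have hN0 : (0 : ℝ) < N := by exact_mod_cast h0
  calc _ ≤ ∑ k ∈ Finset.range N, |ρ N - 1| / N := by
        refine (Finset.abs_sum_le_sum_abs _ _).trans (Finset.sum_le_sum fun n hn => ?_)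
        have hk : (0 : ℝ) < n + 1 := by positivity
        have hn1 : (n : ℝ) + 1 ≤ N := by exact_mod_cast Finset.mem_range.1 hn
        have hu : (((n : ℝ) + 1) / N) ^ 3 ≠ 0 := by positivity
        rw [dslope_arctan_zero hu]
        have e : (((n : ℝ) + 1) / N) ^ 2 * (Real.arctan ((((n : ℝ) + 1) / N) ^ 3) /
            (((n : ℝ) + 1) / N) ^ 3) / N =
            1 / ((n : ℝ) + 1) * Real.arctan ((((n : ℝ) + 1) / N) ^ 3) := by field_simp
        rw [e, ← mul_sub, abs_mul, abs_of_pos (by positivity)]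
        refine (mul_le_mul_of_nonneg_left (abs_arctan_sub_arctan_le _ _) (by positivity)).trans ?_
        rw [← sub_one_mul, abs_mul, abs_of_pos (show 0 < (((n : ℝ) + 1) / N) ^ 3 by positivity)]
        have e2 : 1 / ((n : ℝ) + 1) * (|ρ N - 1| * (((n : ℝ) + 1) / N) ^ 3) =
            |ρ N - 1| / N * (((n : ℝ) + 1) / N) ^ 2 := by field_simp
        rw [e2]
        refine mul_le_of_le_one_right (by positivity) (pow_le_one₀ (by positivity) ?_)
        rwa [div_le_one hN0]
    _ = |ρ N - 1| := by
        rw [Finset.sum_const, Finset.card_range, nsmul_eq_mul]; field_simp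

/-! ### Tails of the kernel -/

theorem latticeKernel_nonneg (A x y : ℝ) : 0 ≤ latticeKernel A x y := by
  unfold latticeKernel; positivity

theorem abs_latticeKernel_right_tail_le {A x a S : ℝ} (hA : 0 < A) (hx : 0 < x) (ha : 0 < a)
    (hS : HasSum (fun k : ℕ => latticeKernel A x (a + k + 1)) S) :
    |S - 1 / (A * x) * Real.arctan (x ^ 3 / (A * a))| ≤ x ^ 2 / (A * a) ^ 2 := by
  refine (abs_tail_sub_antideriv_le (g := fun y => latticeKernel A x y)
    (G := fun y => 1 / (A * x) * Real.arctan (x ^ 3 / (A * y))) (a := a) (fun y hy => ?_)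
    (fun y hy z hz hyz => ?_) (fun _ => latticeKernel_nonneg _ _ _) ?_ hS).trans ?_
  · have hy0 : 0 < y := ha.trans_le hy
    have h1 : HasDerivAt (fun y : ℝ => x ^ 3 / (A * y)) (-(x ^ 3 * A) / (A * y) ^ 2) y := by
      have := (hasDerivAt_const y (x ^ 3)).fun_div ((hasDerivAt_id y).const_mul A)
        (by simp; constructor <;> positivity)
      simpa using this
    convert! h1.arctan.const_mul (1 / (A * x)) using 1
    unfold latticeKernel
    have : x ^ 6 + A ^ 2 * y ^ 2 ≠ 0 := by positivity
    have : 1 + (x ^ 3 / (A * y)) ^ 2 ≠ 0 := by positivity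
    field_simp
    ring
  · have hy0 : 0 < y := ha.trans_le hy
    simp only [latticeKernel]
    gcongr
  · have h1 : Tendsto (fun y : ℝ => x ^ 3 / (A * y)) atTop (𝓝 0) :=
      tendsto_const_nhds.div_atTop (tendsto_id.const_mul_atTop hA)
    simpa using ((Real.continuous_arctan.tendsto 0).comp h1).const_mul (1 / (A * x))
  · simp only [latticeKernel, mul_pow]
    gcongr
    have : 0 < x ^ 6 := by positivity
    linarith

/-- In x the kernel first rises and then falls; A y ≤ a³ places the whole tail in the decreasing
range, as the integral test needs. -/
theorem abs_latticeKernel_left_tail_le {A y a S : ℝ} (hA : 0 < A) (hy : 0 < y) (ha : 0 < a)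
    (hay : A * y ≤ a ^ 3) (hS : HasSum (fun n : ℕ => latticeKernel A (a + n + 1) y) S) :
    |S - 1 / (3 * A * y) * Real.arctan (A * y / a ^ 3)| ≤ 1 / a ^ 4 := by
  refine (abs_tail_sub_antideriv_le (g := fun x => latticeKernel A x y)
    (G := fun x => 1 / (3 * A * y) * Real.arctan (A * y / x ^ 3)) (a := a) (fun x hx => ?_)
    (fun x hx z hz hxz => ?_) (fun _ => latticeKernel_nonneg _ _ _) ?_ hS).trans ?_
  · have hx0 : 0 < x := ha.trans_le hx
    have h1 : HasDerivAt (fun x : ℝ => A * y / x ^ 3) (-(A * y * (3 * x ^ 2)) / (x ^ 3) ^ 2) x := by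
      have := (hasDerivAt_const x (A * y)).fun_div (hasDerivAt_pow 3 x) (by positivity)
      simpa using this
    convert! h1.arctan.const_mul (1 / (3 * A * y)) using 1
    unfold latticeKernel
    have : x ^ 6 + A ^ 2 * y ^ 2 ≠ 0 := by positivity
    have : 1 + (A * y / x ^ 3) ^ 2 ≠ 0 := by positivity
    field_simp
  · have hx' : a ≤ x := hx
    have hx0 : 0 < x := ha.trans_le hx
    have hz0 : 0 < z := hx0.trans_le hxz
    simp only [latticeKernel]
    rw [div_le_div_iff₀ (by positivity) (by positivity)]
    have h2 : x ^ 2 ≤ z ^ 2 := by gcongr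
    -- With B = A y, the cross-multiplied difference factors as (z² - x²)(x²z²(x² + z²) - B²).
    have hb : (A * y) ^ 2 ≤ x ^ 2 * z ^ 2 * (x ^ 2 + z ^ 2) := by
      calc (A * y) ^ 2 ≤ (a ^ 3) ^ 2 := by gcongr
        _ ≤ (x ^ 3) ^ 2 := by gcongr
        _ = x ^ 2 * x ^ 2 * (x ^ 2 + 0) := by ring
        _ ≤ x ^ 2 * z ^ 2 * (x ^ 2 + z ^ 2) := by gcongr; positivity
    nlinarith [mul_nonneg (sub_nonneg.2 h2) (sub_nonneg.2 hb)]
  · have h1 : Tendsto (fun x : ℝ => A * y / x ^ 3) atTop (𝓝 0) :=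
      tendsto_const_nhds.div_atTop (tendsto_pow_atTop (by norm_num))
    simpa using ((Real.continuous_arctan.tendsto 0).comp h1).const_mul (1 / (3 * A * y))
  · simp only [latticeKernel]
    rw [div_le_div_iff₀ (by positivity) (by positivity)]
    have : 0 ≤ A ^ 2 * y ^ 2 := by positivity
    nlinarith

/-! ### Cutoff along x³ = A y and exchange of summation -/

/-- The number of lattice rows `k` with `A k ≤ N³`. -/
noncomputable def rowCutoff (A : ℝ) (N : ℕ) : ℕ := ⌊(N : ℝ) ^ 3 / A⌋₊

theorem tendsto_cube_div_atTop {A : ℝ} (hA : 0 < A) :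
    Tendsto (fun N : ℕ => (N : ℝ) ^ 3 / A) atTop atTop :=
  ((tendsto_pow_atTop (by norm_num)).comp tendsto_natCast_atTop_atTop).atTop_div_const hA

theorem tendsto_rowCutoff {A : ℝ} (hA : 0 < A) : Tendsto (rowCutoff A) atTop atTop :=
  tendsto_nat_floor_atTop.comp (tendsto_cube_div_atTop hA)

theorem tendsto_rowCutoff_ratio {A : ℝ} (hA : 0 < A) :
    Tendsto (fun N : ℕ => A * rowCutoff A N / (N : ℝ) ^ 3) atTop (𝓝 1) := by
  refine ((tendsto_nat_floor_div_atTop (R := ℝ)).comp (tendsto_cube_div_atTop hA)).congr fun N => ?_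
  simp only [Function.comp_apply, rowCutoff]
  rw [div_div_eq_mul_div, mul_comm]

theorem mul_rowCutoff_le {A : ℝ} (hA : 0 < A) (N : ℕ) : A * rowCutoff A N ≤ (N : ℝ) ^ 3 := by
  have := Nat.floor_le (show 0 ≤ (N : ℝ) ^ 3 / A by positivity)
  rw [le_div_iff₀ hA] at this
  rw [mul_comm]
  exact this

/-- Replacing each of the N tails by its arctan costs at most N²/(AK)², in total N³/(AK)², which
vanishes because AK ~ N³. -/
theorem tendsto_sum_right_tail {A : ℝ} (hA : 0 < A) {R : ℕ → ℕ → ℝ}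
    (hR : ∀ N n : ℕ, HasSum (fun k : ℕ => latticeKernel A (n + 1) (rowCutoff A N + k + 1)) (R N n)) :
    Tendsto (fun N : ℕ => ∑ n ∈ Finset.range N, R N n) atTop
      (𝓝 (1 / (3 * A) * ∫ u in (0 : ℝ)..1, dslope Real.arctan 0 u)) := by
  have hρ := tendsto_rowCutoff_ratio hA
  have hρ' : Tendsto (fun N : ℕ => (N : ℝ) ^ 3 / (A * rowCutoff A N)) atTop (𝓝 1) := by
    simpa using hρ.inv₀ one_ne_zero
  have h1 := (tendsto_sum_arctan_cubic hρ').const_mul (1 / A)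
  have hK : Tendsto (fun N : ℕ => A * (rowCutoff A N : ℝ)) atTop atTop :=
    (tendsto_natCast_atTop_atTop.comp (tendsto_rowCutoff hA)).const_mul_atTop hA
  have h2 : Tendsto (fun N : ℕ => (N : ℝ) ^ 3 / (A * rowCutoff A N) * (1 / (A * rowCutoff A N)))
      atTop (𝓝 0) := by
    simpa using hρ'.mul (tendsto_const_nhds (x := (1 : ℝ)).div_atTop hK)
  rw [show 1 / (3 * A) * (∫ u in (0 : ℝ)..1, dslope Real.arctan 0 u) =
    1 / A * ((∫ u in (0 : ℝ)..1, dslope Real.arctan 0 u) / 3) by field_simp]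
  refine h1.congr_dist (squeeze_zero' (.of_forall fun _ => dist_nonneg) ?_ h2)
  filter_upwards [(tendsto_rowCutoff hA).eventually_gt_atTop 0, eventually_gt_atTop 0] with N hK0 hN0
  have hK1 : (0 : ℝ) < rowCutoff A N := by exact_mod_cast hK0
  have hN1 : (0 : ℝ) < N := by exact_mod_cast hN0
  rw [dist_comm, Real.dist_eq, Finset.mul_sum, ← Finset.sum_sub_distrib]
  calc _ ≤ ∑ n ∈ Finset.range N, (N : ℝ) ^ 2 / (A * rowCutoff A N) ^ 2 := by
        refine (Finset.abs_sum_le_sum_abs _ _).trans (Finset.sum_le_sum fun n hn => ?_)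
        have hn0 : (0 : ℝ) < n + 1 := by positivity
        have hn1 : (n : ℝ) + 1 ≤ N := by exact_mod_cast Finset.mem_range.1 hn
        have := abs_latticeKernel_right_tail_le hA hn0 hK1 (hR N n)
        have e : (N : ℝ) ^ 3 / (A * rowCutoff A N) * (((n : ℝ) + 1) / N) ^ 3 =
            ((n : ℝ) + 1) ^ 3 / (A * rowCutoff A N) := by field_simp
        rw [e, ← mul_assoc, div_mul_div_comm, one_mul]
        refine this.trans ?_
        gcongr
    _ = _ := by
        rw [Finset.sum_const, Finset.card_range, nsmul_eq_mul]; field_simp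

/-- Here the K replacements cost 1/N⁴ each, and K/N⁴ is of order 1/N. -/
theorem tendsto_sum_left_tail {A : ℝ} (hA : 0 < A) {C : ℕ → ℕ → ℝ}
    (hC : ∀ N k : ℕ, HasSum (fun n : ℕ => latticeKernel A (N + n + 1) (k + 1)) (C N k)) :
    Tendsto (fun N : ℕ => ∑ k ∈ Finset.range (rowCutoff A N), C N k) atTop
      (𝓝 (1 / (3 * A) * ∫ u in (0 : ℝ)..1, dslope Real.arctan 0 u)) := by
  have hρ := tendsto_rowCutoff_ratio hA
  have h1 := (tendsto_sum_arctan_linear (tendsto_rowCutoff hA) hρ).const_mul (1 / (3 * A))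
  have h2 : Tendsto (fun N : ℕ => A * rowCutoff A N / (N : ℝ) ^ 3 * (1 / A * (1 / N)))
      atTop (𝓝 0) := by
    simpa using hρ.mul ((tendsto_one_div_atTop_nhds_zero_nat (𝕜 := ℝ)).const_mul (1 / A))
  refine h1.congr_dist (squeeze_zero' (.of_forall fun _ => dist_nonneg) ?_ h2)
  filter_upwards [(tendsto_rowCutoff hA).eventually_gt_atTop 0, eventually_gt_atTop 0] with N hK0 hN0
  have hK1 : (0 : ℝ) < rowCutoff A N := by exact_mod_cast hK0
  have hN1 : (0 : ℝ) < N := by exact_mod_cast hN0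
  rw [dist_comm, Real.dist_eq, Finset.mul_sum, ← Finset.sum_sub_distrib]
  calc _ ≤ ∑ k ∈ Finset.range (rowCutoff A N), 1 / (N : ℝ) ^ 4 := by
        refine (Finset.abs_sum_le_sum_abs _ _).trans (Finset.sum_le_sum fun k hk => ?_)
        have hk0 : (0 : ℝ) < k + 1 := by positivity
        have hk1 : (k : ℝ) + 1 ≤ rowCutoff A N := by exact_mod_cast Finset.mem_range.1 hk
        have := abs_latticeKernel_left_tail_le hA hk0 hN1
          ((mul_le_mul_of_nonneg_left hk1 hA.le).trans (mul_rowCutoff_le hA N)) (hC N k)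
        have e : A * rowCutoff A N / (N : ℝ) ^ 3 * (((k : ℝ) + 1) / rowCutoff A N) =
            A * ((k : ℝ) + 1) / (N : ℝ) ^ 3 := by field_simp
        rw [e, ← mul_assoc, div_mul_div_comm, one_mul]
        exact this
    _ = _ := by
        rw [Finset.sum_const, Finset.card_range, nsmul_eq_mul]; field_simp

/-- The two iterated sums of the lattice kernel agree when cut off along `x³ = A y`. -/
theorem tendsto_iterated_sum_sub {A : ℝ} (hA : 0 < A) {r c : ℕ → ℝ}
    (hr : ∀ n : ℕ, HasSum (fun k : ℕ => latticeKernel A (n + 1) (k + 1)) (r n))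
    (hc : ∀ k : ℕ, HasSum (fun n : ℕ => latticeKernel A (n + 1) (k + 1)) (c k)) :
    Tendsto (fun N : ℕ => ∑ n ∈ Finset.range N, r n - ∑ k ∈ Finset.range (rowCutoff A N), c k)
      atTop (𝓝 0) := by
  have h1 := tendsto_sum_right_tail hA
    (R := fun N n => r n - ∑ k ∈ Finset.range (rowCutoff A N), latticeKernel A (n + 1) (k + 1))
    fun N n => by
      convert! (hasSum_nat_add_iff' (rowCutoff A N)).2 (hr n) using 1
      ext k; push_cast; rw [add_comm (k : ℝ)]
  have h2 := tendsto_sum_left_tail hA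
    (C := fun N k => c k - ∑ n ∈ Finset.range N, latticeKernel A (n + 1) (k + 1))
    fun N k => by
      convert! (hasSum_nat_add_iff' N).2 (hc k) using 1
      ext n; push_cast; rw [add_comm (n : ℝ)]
  have := h1.sub h2
  rw [sub_self] at this
  -- The finite N × K block occurs in both tails and drops out after its two sums are swapped.
  refine this.congr fun N => ?_
  simp only [Finset.sum_sub_distrib]
  rw [Finset.sum_comm]
  ring

/-! ### The limiting constant -/

theorem harmonic_eq_sum (N : ℕ) :
    ((harmonic N : ℚ) : ℝ) = ∑ n ∈ Finset.range N, 1 / ((n : ℝ) + 1) := by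
  simp [harmonic]

theorem tendsto_lambert_partial_sums {A : ℝ} (hA : 0 < A) {r c : ℕ → ℝ}
    (hr : ∀ n : ℕ, HasSum (fun k : ℕ => latticeKernel A (n + 1) (k + 1)) (r n))
    (hc : ∀ k : ℕ, HasSum (fun n : ℕ => latticeKernel A (n + 1) (k + 1)) (c k)) :
    Tendsto (fun N : ℕ =>
      ∑ n ∈ Finset.range N, (A / Real.pi * r n - 1 / (2 * ((n : ℝ) + 1))
        + A / (2 * Real.pi * ((n : ℝ) + 1) ^ 4)) +
      1 / 3 * ∑ k ∈ Finset.range (rowCutoff A N),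
        (1 / (2 * ((k : ℝ) + 1)) - 3 * A / Real.pi * c k))
      atTop (𝓝 (A * Real.pi ^ 3 / 180 - Real.eulerMascheroniConstant / 3 - Real.log A / 6)) := by
  have hπ := Real.pi_ne_zero
  have h1 := (tendsto_iterated_sum_sub hA hr hc).const_mul (A / Real.pi)
  have h2 : Tendsto (fun N : ℕ => ∑ n ∈ Finset.range N, 1 / ((n : ℝ) + 1) ^ 4) atTop
      (𝓝 (Real.pi ^ 4 / 90)) := by
    have := ((hasSum_nat_add_iff' 1).2 hasSum_zeta_four).tendsto_sum_nat
    simpa using this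
  have h3 := Real.tendsto_harmonic_sub_log
  have h4 := h3.comp (tendsto_rowCutoff hA)
  have h5 : Tendsto (fun N : ℕ => Real.log (A * rowCutoff A N / (N : ℝ) ^ 3)) atTop (𝓝 0) := by
    simpa using (tendsto_rowCutoff_ratio hA).log one_ne_zero
  -- The logarithms in -½(H_N - log N) + ⅙(H_K - log K) + ⅙ log(AK/N³) - ⅙ log A cancel, leaving the
  -- harmonic terms of the statement.
  have key := ((((h1.add (h2.const_mul (A / (2 * Real.pi)))).sub (h3.const_mul (1 / 2))).add
    (h4.const_mul (1 / 6))).add (h5.const_mul (1 / 6))).sub_const (Real.log A / 6)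
  refine (key.congr' ?_).trans (le_of_eq ?_)
  · filter_upwards [(tendsto_rowCutoff hA).eventually_gt_atTop 0, eventually_gt_atTop 0]
      with N hK0 hN0
    have hK1 : (rowCutoff A N : ℝ) ≠ 0 := by exact_mod_cast hK0.ne'
    have hN1 : (N : ℝ) ≠ 0 := by exact_mod_cast hN0.ne'
    rw [Real.log_div (by positivity) (by positivity), Real.log_mul hA.ne' hK1, Real.log_pow]
    simp only [Function.comp_apply, harmonic_eq_sum, Finset.sum_sub_distrib, Finset.sum_add_distrib]
    have e1 (M : ℕ) : ∑ n ∈ Finset.range M, 1 / (2 * ((n : ℝ) + 1)) =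
        1 / 2 * ∑ n ∈ Finset.range M, 1 / ((n : ℝ) + 1) := by
      rw [Finset.mul_sum]; exact Finset.sum_congr rfl fun n _ => by field_simp
    have e2 : ∑ n ∈ Finset.range N, A / (2 * Real.pi * ((n : ℝ) + 1) ^ 4) =
        A / (2 * Real.pi) * ∑ n ∈ Finset.range N, 1 / ((n : ℝ) + 1) ^ 4 := by
      rw [Finset.mul_sum]; exact Finset.sum_congr rfl fun n _ => by field_simp
    rw [e1, e1, e2, ← Finset.mul_sum, ← Finset.mul_sum]
    push_cast
    ring
  · congr 1
    field_simp
    ring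

/-! ### Convergence and assembly -/

/-- The cubic Taylor term of exp is just enough for exponents growing like n^(1/3): it bounds
|exp(w) - 1| below by a multiple of n, hence the terms by a multiple of 1/n². -/
theorem summable_one_div_mul_exp_sub_one {w : ℕ+ → ℂ} {c : ℝ} (hc : 0 < c)
    (hw0 : ∀ n, 0 < (w n).re) (hw : ∀ n : ℕ+, c * n ≤ (w n).re ^ 3) :
    Summable (fun n : ℕ+ => 1 / ((n : ℂ) * (Complex.exp (w n) - 1))) := by
  have hs : Summable (fun n : ℕ+ => 6 / c * (1 / ((n : ℕ) : ℝ) ^ 2)) :=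
    ((Real.summable_one_div_nat_pow.2 one_lt_two).comp_injective PNat.coe_injective).mul_left _
  refine Summable.of_norm_bounded hs fun n => ?_
  have hn : (0 : ℝ) < (n : ℕ) := by exact_mod_cast n.pos
  have h1 : (w n).re ^ 3 / 6 ≤ Real.exp (w n).re - 1 := by
    have h := Real.sum_le_exp_of_nonneg (hw0 n).le 4
    simp [Finset.sum_range_succ, Nat.factorial] at h
    nlinarith [hw0 n, sq_nonneg (w n).re]
  have h2 : c * n / 6 ≤ ‖Complex.exp (w n) - 1‖ := by
    have h := norm_sub_norm_le (Complex.exp (w n)) 1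
    rw [Complex.norm_exp, norm_one] at h
    linarith [hw n]
  rw [norm_div, norm_one, norm_mul, Complex.norm_natCast]
  calc 1 / ((n : ℝ) * ‖Complex.exp (w n) - 1‖) ≤ 1 / ((n : ℝ) * (c * n / 6)) := by gcongr
    _ = 6 / c * (1 / (n : ℝ) ^ 2) := by field_simp

theorem tendsto_sum_range_succ_tsum_pnat {f : ℕ → ℂ} (hf : Summable fun n : ℕ+ => f n) :
    Tendsto (fun N => ∑ n ∈ Finset.range N, f (n + 1)) atTop (𝓝 (∑' n : ℕ+, f n)) := by
  rw [tsum_pnat_eq_tsum_succ (f := f)]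
  exact (summable_pnat_iff_summable_succ.1 hf).hasSum.tendsto_sum_nat

theorem mainTheorem11 (α β : ℝ) (hα : 0 < α) (hβ : 0 < β) (hαβ : α * β ^ 3 = Real.pi ^ 4)
    (ω : ℂ) (hω : ω = (-1 + (Real.sqrt 3 : ℂ) * Complex.I) / 2) :
    Summable (fun n : ℕ+ => 1 / ((n : ℂ) * (Complex.exp (8 * (n : ℂ) ^ 3 * (α : ℂ)) - 1))) ∧
    Summable (fun n : ℕ+ => 1 / ((n : ℂ) *
      (Complex.exp ((((2 * (n : ℝ)) ^ (1 / 3 : ℝ) : ℝ) : ℂ) * (β : ℂ)) - 1))) ∧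
    Summable (fun n : ℕ+ => 1 / ((n : ℂ) *
      (Complex.exp (-(((2 * (n : ℝ)) ^ (1 / 3 : ℝ) : ℝ) : ℂ) * (β : ℂ) * ω) - 1))) ∧
    Summable (fun n : ℕ+ => 1 / ((n : ℂ) *
      (Complex.exp (-(((2 * (n : ℝ)) ^ (1 / 3 : ℝ) : ℝ) : ℂ) * (β : ℂ) * ω ^ 2) - 1))) ∧
    (∑' n : ℕ+, 1 / ((n : ℂ) * (Complex.exp (8 * (n : ℂ) ^ 3 * (α : ℂ)) - 1))) +
      (1 / 3) *
        ((∑' n : ℕ+, 1 / ((n : ℂ) *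
            (Complex.exp ((((2 * (n : ℝ)) ^ (1 / 3 : ℝ) : ℝ) : ℂ) * (β : ℂ)) - 1))) -
          (∑' n : ℕ+, 1 / ((n : ℂ) *
            (Complex.exp (-(((2 * (n : ℝ)) ^ (1 / 3 : ℝ) : ℝ) : ℂ) * (β : ℂ) * ω) - 1))) -
          (∑' n : ℕ+, 1 / ((n : ℂ) *
            (Complex.exp (-(((2 * (n : ℝ)) ^ (1 / 3 : ℝ) : ℝ) : ℂ) * (β : ℂ) * ω ^ 2) - 1)))) =
      (((1 / 3 : ℝ) * (Real.log 2 - Real.eulerMascheroniConstant) +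
        (1 / 8 : ℝ) * Real.log (α / β) + β ^ 3 / 720 : ℝ) : ℂ) := by
  -- Chosen so that 2πn³/A = 8n³α; then αβ³ = π⁴ makes (2k)^(1/3) β/(2π) the cube root of A k.
  obtain ⟨A, hA⟩ : ∃ A : ℝ, A = Real.pi / (4 * α) := ⟨_, rfl⟩
  have hπ := Real.pi_pos
  have hA0 : 0 < A := by rw [hA]; positivity
  have hre : ω.re = -1 / 2 := by rw [hω]; simp
  have hs3 : (Real.sqrt 3 : ℂ) ^ 2 = 3 := by
    norm_cast; exact Real.sq_sqrt (by norm_num)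
  have hω2 : ω ^ 2 = -1 - ω := by
    rw [hω]
    linear_combination (1 / 4 : ℂ) * (Real.sqrt 3 : ℂ) ^ 2 * Complex.I_sq - (1 / 4 : ℂ) * hs3
  have hre2 : (ω ^ 2).re = -1 / 2 := by rw [hω2]; simp [hre]; norm_num
  have hroot (x : ℝ) (hx : 0 < x) : 0 < (2 * x) ^ (1 / 3 : ℝ) ∧ ((2 * x) ^ (1 / 3 : ℝ)) ^ 3 = 2 * x := by
    refine ⟨by positivity, ?_⟩
    rw [← Real.rpow_natCast, ← Real.rpow_mul (by positivity)]
    norm_num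
  have hpn (n : ℕ+) : (1 : ℝ) ≤ (n : ℕ) := by exact_mod_cast n.pos
  have S1 : Summable (fun n : ℕ+ => 1 / ((n : ℂ) * (Complex.exp (8 * (n : ℂ) ^ 3 * (α : ℂ)) - 1))) := by
    have hr (n : ℕ+) : (8 * (n : ℂ) ^ 3 * (α : ℂ)).re = 8 * (n : ℝ) ^ 3 * α := by
      rw [← Complex.ofReal_re (8 * (n : ℝ) ^ 3 * α)]; push_cast; rfl
    refine summable_one_div_mul_exp_sub_one (c := 512 * α ^ 3) (by positivity) (fun n => ?_)
      fun n => ?_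
    · rw [hr]; have := hpn n; positivity
    · rw [hr]
      have := le_self_pow₀ (hpn n) (show 9 ≠ 0 by norm_num)
      calc 512 * α ^ 3 * (n : ℝ) ≤ 512 * α ^ 3 * (n : ℝ) ^ 9 := by gcongr
        _ = _ := by ring
  have S2 : Summable (fun n : ℕ+ => 1 / ((n : ℂ) *
      (Complex.exp ((((2 * (n : ℝ)) ^ (1 / 3 : ℝ) : ℝ) : ℂ) * (β : ℂ)) - 1))) := by
    refine summable_one_div_mul_exp_sub_one (c := 2 * β ^ 3) (by positivity) (fun n => ?_)
      fun n => ?_ <;> obtain ⟨h0, h3⟩ := hroot n (by linarith [hpn n]) <;>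
      rw [← Complex.ofReal_mul, Complex.ofReal_re]
    · positivity
    · rw [mul_pow, h3]; linarith
  have S34 (u : ℂ) (hu : u.re = -1 / 2) : Summable (fun n : ℕ+ => 1 / ((n : ℂ) *
      (Complex.exp (-(((2 * (n : ℝ)) ^ (1 / 3 : ℝ) : ℝ) : ℂ) * (β : ℂ) * u) - 1))) := by
    refine summable_one_div_mul_exp_sub_one (c := β ^ 3 / 4) (by positivity) (fun n => ?_)
      fun n => ?_ <;> obtain ⟨h0, h3⟩ := hroot n (by linarith [hpn n]) <;>
      rw [← Complex.ofReal_neg, ← Complex.ofReal_mul, Complex.re_ofReal_mul, hu]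
    · have : 0 < (2 * (n : ℝ)) ^ (1 / 3 : ℝ) * β := by positivity
      linarith
    · rw [mul_pow, mul_pow, neg_pow, h3]; linarith
  refine ⟨S1, S2, S34 ω hre, S34 (ω ^ 2) hre2, ?_⟩
  have hr (n : ℕ) := hasSum_latticeKernel_right hA0 (show (0 : ℝ) < n + 1 by positivity)
  have hroot' (k : ℕ) := hroot (k + 1) (by positivity)
  have hc3 (k : ℕ) : ((2 * ((k : ℝ) + 1)) ^ (1 / 3 : ℝ) * β / (2 * Real.pi)) ^ 3 = A * (k + 1) := by
    rw [div_pow, mul_pow, (hroot' k).2, hA, div_eq_iff (by positivity)]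
    field_simp
    linear_combination 4 * hαβ
  have hc (k : ℕ) := hasSum_latticeKernel_left
    (c := (2 * ((k : ℝ) + 1)) ^ (1 / 3 : ℝ) * β / (2 * Real.pi))
    (by have := (hroot' k).1; positivity) (hc3 k) hω
  -- The column sum is real but its closed form is complex. Naming it by the real `tsum` lets the
  -- real limit apply; the closed form returns after casting.
  have hc' (k : ℕ) := (Complex.summable_ofReal.1 (hc k).summable).hasSum
  have T1 := tendsto_sum_range_succ_tsum_pnat
    (f := fun n : ℕ => 1 / ((n : ℂ) * (Complex.exp (8 * (n : ℂ) ^ 3 * (α : ℂ)) - 1))) S1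
  have T2 := (tendsto_sum_range_succ_tsum_pnat (f := fun n : ℕ => 1 / ((n : ℂ) *
      (Complex.exp ((((2 * (n : ℝ)) ^ (1 / 3 : ℝ) : ℝ) : ℂ) * (β : ℂ)) - 1))) S2).comp
      (tendsto_rowCutoff hA0)
  have T34 (u : ℂ) (hu : u.re = -1 / 2) := (tendsto_sum_range_succ_tsum_pnat
      (f := fun n : ℕ => 1 / ((n : ℂ) *
      (Complex.exp (-(((2 * (n : ℝ)) ^ (1 / 3 : ℝ) : ℝ) : ℂ) * (β : ℂ) * u) - 1)))
      (S34 u hu)).comp (tendsto_rowCutoff hA0)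
  have key := (Complex.continuous_ofReal.tendsto _).comp (tendsto_lambert_partial_sums hA0 hr hc')
  refine tendsto_nhds_unique
    (T1.add (((T2.sub (T34 ω hre)).sub (T34 (ω ^ 2) hre2)).const_mul (1 / 3)))
    ((key.congr fun N => ?_).trans (le_of_eq (congrArg 𝓝 ?_)))
  · simp only [Function.comp_apply]
    rw [← Finset.sum_sub_distrib, ← Finset.sum_sub_distrib]
    push_cast
    congr 1
    · refine Finset.sum_congr rfl fun n _ => ?_
      have hn : (n : ℂ) + 1 ≠ 0 := by exact_mod_cast n.succ_ne_zero
      have e : 2 * (Real.pi : ℂ) * (((n : ℂ) + 1) ^ 3 / A) = 8 * ((n : ℂ) + 1) ^ 3 * α := by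
        have : (α : ℂ) ≠ 0 := by exact_mod_cast hα.ne'
        have : (Real.pi : ℂ) ≠ 0 := by exact_mod_cast hπ.ne'
        rw [hA]; push_cast; field_simp; norm_num
      rw [e]
      have : (A : ℂ) ≠ 0 := by exact_mod_cast hA0.ne'
      have : (Real.pi : ℂ) ≠ 0 := by exact_mod_cast hπ.ne'
      generalize 1 / (((n : ℂ) + 1) * (Complex.exp (8 * ((n : ℂ) + 1) ^ 3 * α) - 1)) = s
      field_simp
      ring
    · congr 1
      refine Finset.sum_congr rfl fun k _ => ?_
      have hk : (k : ℂ) + 1 ≠ 0 := by exact_mod_cast k.succ_ne_zero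
      have hA' : (A : ℂ) ≠ 0 := by exact_mod_cast hA0.ne'
      have hπ' : (Real.pi : ℂ) ≠ 0 := by exact_mod_cast hπ.ne'
      rw [(hc k).tsum_eq]
      have e0 : 2 * (Real.pi : ℂ) * ((2 * ((k : ℝ) + 1)) ^ (1 / 3 : ℝ) * β / (2 * Real.pi) : ℝ) =
          ((2 * ((k : ℝ) + 1)) ^ (1 / 3 : ℝ) : ℝ) * β := by
        rw [Complex.ofReal_div, Complex.ofReal_mul]; push_cast; field_simp
      have e1 (u : ℂ) : 2 * (Real.pi : ℂ) *
          (-((2 * ((k : ℝ) + 1)) ^ (1 / 3 : ℝ) * β / (2 * Real.pi) : ℝ) * u) =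
          -((2 * ((k : ℝ) + 1)) ^ (1 / 3 : ℝ) : ℝ) * β * u := by
        linear_combination -u * e0
      rw [e0, e1, e1]
      simp only [one_div, mul_inv]
      push_cast
      field_simp
      ring
  · congr 1
    have hl : 3 * Real.log β = 4 * Real.log Real.pi - Real.log α := by
      have := congrArg Real.log hαβ
      rw [Real.log_mul hα.ne' (by positivity), Real.log_pow, Real.log_pow] at this
      push_cast at this
      linarith
    have hl4 : Real.log 4 = 2 * Real.log 2 := by
      rw [show (4 : ℝ) = 2 ^ 2 by norm_num, Real.log_pow]; norm_num
    have hβ3 : A * Real.pi ^ 3 / 180 = β ^ 3 / 720 := by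
      rw [hA]; field_simp; linear_combination -720 * hαβ
    rw [hβ3, hA, Real.log_div hπ.ne' (by positivity), Real.log_mul (by norm_num) hα.ne',
      Real.log_div hα.ne' hβ.ne', hl4]
    -- Eliminating log π turns ⅙ log(α/π) into ⅛ log(α/β).
    linear_combination (1 / 24 : ℝ) * hl
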